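/- \textbf{Model.} A \emph{dynamic network} on the system $V=\{1,\dots,n\}$ of $n\ge 1$ processes is a sequence $\mathcal G=(G_i)_{i\ge 1}$ of undirected multigraphs $G_i=(V,E_i)$, where $E_i(\{p,q\})\in\mathbb N$ is the number of links between $p$ and $q$ at round $i$ (parallel links and self-loops are allowed). It is \emph{$1$-interval-connected} if every $G_i$ is connected. A (uniform, anonymous) \emph{deterministic algorithm} with input set $\mathcal I$ and output set $\mathcal O$ consists of a set of states $\mathcal S=\mathcal S_N\sqcup\mathcal S_T$ (non-terminal and terminal states), an input map $\iota:\mathcal I\to\mathcal S$, an output map $\omega:\mathcal S_T\to\mathcal O$ and a function $\mathcal A$ that assigns a state to every pair of a state in $\mathcal S_N$ and a finite multiset of states. Given $\mathcal G$ and an input assignment $\lambda:V\to\mathcal I$, the states $\sigma_i(p)$ of the processes are $\sigma_0(p)=\iota(\lambda(p))$ and, for $i\geq 1$, $\sigma_i(p)=\sigma_{i-1}(p)$ if $\sigma_{i-1}(p)\in\mathcal S_T$, and $\sigma_i(p)=\mathcal A(\sigma_{i-1}(p),M_i(p))$ otherwise, where $M_i(p)$ is the multiset that contains the state $\sigma_{i-1}(q)$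 with $E_i(\{p,q\})$ copies for every $q\in V$. The execution \emph{terminates in $t$ rounds} if $t$ is the least number such that $\sigma_t(p)\in\mathcal S_T$ for all $p\in V$; the output of $p$ is then $\omega(\sigma_t(p))$. \textbf{Theorem.} Let $\mathcal I'$ be any set and let $\mathcal I=\{L,N\}\times\mathcal I'$, where the first component of an input is a leader flag. There is a deterministic algorithm with input set $\mathcal I$ (a single one for all $n$, independent of the network) that solves the Generalized Counting problem with termination in at most $3n-2$ rounds in every $1$-interval-connected network with a unique leader. That is, for every $n\ge 1$, every $1$-interval-connected dynamic network $\mathcal G$ on $n$ processes, and every input assignment $\lambda:\{1,\dots,n\}\to\mathcal I$ such that exactly one process has the flag $L$, the execution terminates in at most $3n-2$ rounds, and every process outputs the multiset $\{\lambda(1),\dots,\lambda(n)\}$ of all inputs. -/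

import Mathlib

universe u v

namespace AnonNet

/-- An undirected multigraph on `V`: a multiset of unordered pairs of elements of `V`, given by
the multiplicity of every possible link. Parallel links and self-loops are allowed. -/
abbrev Multigraph (V : Type) : Type := Sym2 V → ℕ

/-- The simple graph of the pairs of distinct vertices joined by at least one link. -/
def Multigraph.support {V : Type} (E : Multigraph V) : SimpleGraph V where
  Adj p q := p ≠ q ∧ 0 < E s(p, q)
  symm := by
    constructor
    intro p q h
    exact ⟨h.1.symm, by rw [Sym2.eq_swap]; exact h.2⟩
  loopless := by
    constructor
    intro p h
    exact h.1 rfl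

/-- A multigraph is connected if any two vertices are joined by a path of links. -/
def Multigraph.Connected {V : Type} (E : Multigraph V) : Prop := E.support.Connected

/-- A dynamic network on the system `Fin n` of `n` processes: `G i` is the topology at round `i`,
for `i ≥ 1`. (Rounds are numbered from `1`, the value `G 0` is never used.) -/
abbrev DynamicNetwork (n : ℕ) : Type := ℕ → Multigraph (Fin n)

/-- The topology is connected at every round. -/
def DynamicNetwork.OneIntervalConnected {n : ℕ} (G : DynamicNetwork n) : Prop :=
  ∀ i, 1 ≤ i → (G i).Connected

/-- The computation parameters of a uniform deterministic algorithm for anonymous processes with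
inputs in `I` and outputs in `O`. The set of internal states is partitioned into non-terminal and
terminal ones, i.e., it is the disjoint union `NonTerminal ⊕ Terminal`. Neither the number of
processes nor the identity of a process is available to any of the maps. -/
structure Algorithm (I : Type u) (O : Type v) where
  /-- the non-terminal internal states -/
  NonTerminal : Type u
  /-- the terminal internal states -/
  Terminal : Type u
  /-- the input map, which gives the initial state of a process -/
  init : I → NonTerminal ⊕ Terminal
  /-- the output map -/
  output : Terminal → O
  /-- the local computation: the new state of a process, as a function of its non-terminal current
  state and of the multiset of the states that it receives -/
  step : NonTerminal → Multiset (NonTerminal ⊕ Terminal) → NonTerminal ⊕ Terminal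

namespace Algorithm

variable {I : Type u} {O : Type v}

/-- The internal states. -/
abbrev State (A : Algorithm I O) : Type u := A.NonTerminal ⊕ A.Terminal

/-- The multiset of states received by process `p` when the processes have states `σ` and the
topology is `E`: one copy of the state of `q` for every link between `p` and `q`. -/
def received (A : Algorithm I O) {n : ℕ} (E : Multigraph (Fin n)) (σ : Fin n → A.State)
    (p : Fin n) : Multiset A.State :=
  ∑ q : Fin n, E s(p, q) • ({σ q} : Multiset A.State)

/-- The new state of process `p` after a round with topology `E` in which the processes broadcast
the states `σ`. A terminal state never changes. -/
def next (A : Algorithm I O) {n : ℕ} (E : Multigraph (Fin n)) (σ : Fin n → A.State)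
    (p : Fin n) : A.State :=
  match σ p with
  | Sum.inl s => A.step s (A.received E σ p)
  | Sum.inr s => Sum.inr s

/-- The state of every process after round `i`, in the execution on the dynamic network `G` with
input assignment `lam`. After round `0` processes have their initial states. -/
def state (A : Algorithm I O) {n : ℕ} (G : DynamicNetwork n) (lam : Fin n → I) :
    ℕ → Fin n → A.State
  | 0 => fun p => A.init (lam p)
  | i + 1 => A.next (G (i + 1)) (A.state G lam i)

/-- After round `t`, all processes are in a terminal state. -/
def AllTerminal (A : Algorithm I O) {n : ℕ} (G : DynamicNetwork n) (lam : Fin n → I)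
    (t : ℕ) : Prop :=
  ∀ p, ∃ s : A.Terminal, A.state G lam t p = Sum.inr s

/-- The execution terminates in `t` rounds: all processes are in a terminal state for the first
time after round `t`. -/
def TerminatesIn (A : Algorithm I O) {n : ℕ} (G : DynamicNetwork n) (lam : Fin n → I)
    (t : ℕ) : Prop :=
  A.AllTerminal G lam t ∧ ∀ t' < t, ¬ A.AllTerminal G lam t'

/-- After round `t`, all processes are in a terminal state and the output of each process `p`
is `ζ p`. -/
def HasOutput (A : Algorithm I O) {n : ℕ} (G : DynamicNetwork n) (lam : Fin n → I)
    (t : ℕ) (ζ : Fin n → O) : Prop :=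
  ∀ p, ∃ s : A.Terminal, A.state G lam t p = Sum.inr s ∧ A.output s = ζ p

end Algorithm

/-- A problem prescribes the outputs of the processes for every input assignment. -/
abbrev Problem (I : Type u) (O : Type v) : Type (max u v) :=
  ∀ n : ℕ, (Fin n → I) → (Fin n → O)

/-- The inventory of an input assignment: the multiset of the inputs of all processes. -/
def inventory {I : Type u} {n : ℕ} (lam : Fin n → I) : Multiset I :=
  (Finset.univ : Finset (Fin n)).val.map lam

/-- The Generalized Counting problem: every process has to output the multiset of all inputs. -/
def generalizedCounting (I : Type u) : Problem I (Multiset I) :=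
  fun _ lam _ => inventory lam

/-- The leader flag of an input. -/
inductive LeaderFlag : Type
  | leader
  | nonLeader

/-- An input assignment with leader flags is valid if there is exactly one leader. -/
def HasUniqueLeader {I : Type u} {n : ℕ} (lam : Fin n → LeaderFlag × I) : Prop :=
  ∃! p, (lam p).1 = LeaderFlag.leader

/-- The algorithm `A` solves the problem `π`, with termination, in at most `f n` rounds in every
`1`-interval-connected anonymous dynamic network of `n` processes with a unique leader. -/
def SolvesWithLeaderIn {I : Type u} {O : Type v} (A : Algorithm (LeaderFlag × I) O)
    (π : Problem (LeaderFlag × I) O) (f : ℕ → ℕ) : Prop :=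
  ∀ (n : ℕ) (G : DynamicNetwork n) (lam : Fin n → LeaderFlag × I),
    1 ≤ n → G.OneIntervalConnected → HasUniqueLeader lam →
      ∃ t ≤ f n, A.TerminatesIn G lam t ∧ A.HasOutput G lam t (π n lam)

end AnonNet

/-! Processes collect full-information views and stop when a view is compatible with only one
inventory. The point is that every view after round `3 * n - 2` is such (`inventory_eq_of_view_eq`).
Let `G`, with `n` processes, and `G'` share such a view. Connectivity spreads information to all of
`G` in `n - 1` rounds, so every view of `G` up to round `2 * n - 1` occurs in `G'`. If at some round
`s < 2 * n - 1` each view of `G` has equally many holders in both networks, then exactly `n`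
processes of `G'` hold views of `G`. The remaining rounds, at least `n`, would expose any further
process of `G'`, so the inventories agree.

Suppose there is no such `s`. In a round where no class of `G` splits, counting links between
classes from both sides carries equality of sizes along links, starting from the leader's singleton
class. Where this fails, a class loses processes in `G'` and drops to at most its size in `G`
(`exists_card_viewClass_lt`). Let `F` collect such classes and `P` be the holders in `G'` of views
of `F`. Then |F| + #views of `G` + #views of `F` - |P| starts at 1 or more and gains at least 1 per
round (`exists_lossy_set`). It never exceeds `2 * n - 1`, because the leader stays outside `F` and
each view of `F` has a holder in `P`. After `2 * n - 1` rounds this is a contradiction. -/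

namespace AnonNet

/-! ### Full-information views -/

variable {J : Type u}

/-- The full-information views after `t` rounds: a view after round `t + 1` consists of the
previous view and of the multiset of the views received. -/
def View (J : Type u) : ℕ → Type u
  | 0 => J
  | t + 1 => View J t × Multiset (View J t)

/-- The view before the last round. -/
def View.prev {t : ℕ} (w : View J (t + 1)) : View J t := w.1

/-- The input of a process, as recorded in its view. -/
def View.root : (t : ℕ) → View J t → J
  | 0, x => x
  | t + 1, w => View.root t w.1

/-- The view of every process after round `t`. -/
def view {n : ℕ} (G : DynamicNetwork n) (lam : Fin n → J) : (t : ℕ) → Fin n → View J t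
  | 0 => lam
  | t + 1 => fun p => (view G lam t p,
      ∑ q : Fin n, G (t + 1) s(p, q) • ({view G lam t q} : Multiset (View J t)))

section Views

variable {n : ℕ} (G : DynamicNetwork n) (lam : Fin n → J)

lemma prev_view_succ (t : ℕ) (p : Fin n) : (view G lam (t + 1) p).prev = view G lam t p := rfl

lemma view_eq_of_succ {n' : ℕ} {G : DynamicNetwork n} {lam : Fin n → J} {G' : DynamicNetwork n'}
    {lam' : Fin n' → J} {t : ℕ} {p : Fin n} {p' : Fin n'}
    (h : view G lam (t + 1) p = view G' lam' (t + 1) p') :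
    view G lam t p = view G' lam' t p' := congrArg View.prev h

lemma root_view (t : ℕ) (p : Fin n) : View.root t (view G lam t p) = lam p := by
  induction t with
  | zero => rfl
  | succ t ih => exact ih

lemma mem_view_succ_snd (t : ℕ) (p : Fin n) (w : View J t) :
    w ∈ (view G lam (t + 1) p).2 ↔ ∃ q, 0 < G (t + 1) s(p, q) ∧ view G lam t q = w := by
  change w ∈ ∑ q : Fin n, G (t + 1) s(p, q) • ({view G lam t q} : Multiset (View J t)) ↔ _
  rw [Multiset.mem_sum]
  constructor
  · rintro ⟨q, -, hq⟩
    rw [Multiset.mem_nsmul] at hq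
    exact ⟨q, Nat.pos_of_ne_zero hq.1, (Multiset.mem_singleton.1 hq.2).symm⟩
  · rintro ⟨q, hq, rfl⟩
    exact ⟨q, Finset.mem_univ _, Multiset.mem_nsmul.2 ⟨hq.ne', Multiset.mem_singleton_self _⟩⟩

/-! ### Spread of information -/

/-- The processes whose state after round `t - k` can influence the state of `p` after
round `t`. -/
def heard (t : ℕ) (p : Fin n) : ℕ → Set (Fin n)
  | 0 => {p}
  | k + 1 => heard t p k ∪ {q | ∃ r ∈ heard t p k, 0 < G (t - k) s(r, q)}

variable {G}

/-- A nonempty proper set of vertices of a connected multigraph is left by some link. -/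
lemma Multigraph.Connected.exists_link {V : Type} {E : Multigraph V} (hE : E.Connected)
    {S : Set V} {a b : V} (ha : a ∈ S) (hb : b ∉ S) : ∃ x ∈ S, ∃ y ∉ S, 0 < E s(x, y) := by
  obtain ⟨w⟩ := hE.preconnected a b
  obtain ⟨d, -, h1, h2⟩ := w.exists_boundary_dart S ha hb
  exact ⟨_, h1, _, h2, d.adj.2⟩

/-- Going one round further back, some link leaves the set as long as it is not everything, so it
gains a process. -/
lemma le_ncard_heard (hG : G.OneIntervalConnected) (t : ℕ) (p : Fin n) (k : ℕ) (hk : k ≤ t) :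
    min n (k + 1) ≤ (heard G t p k).ncard := by
  induction k with
  | zero => simp [heard]
  | succ k ih =>
    have ih := ih (by omega)
    have hsub : heard G t p k ⊆ heard G t p (k + 1) := Set.subset_union_left
    by_cases hall : heard G t p k = Set.univ
    · have : heard G t p (k + 1) = Set.univ := Set.univ_subset_iff.1 (hall ▸ hsub)
      rw [this, Set.ncard_univ, Nat.card_fin]
      exact min_le_left _ _
    · obtain ⟨b, hb⟩ := (Set.ne_univ_iff_exists_notMem _).1 hall
      have hp : p ∈ heard G t p k := by
        clear * -
        induction k with
        | zero => exact rfl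
        | succ k ih => exact Or.inl ih
      obtain ⟨x, hx, y, hy, hxy⟩ := (hG (t - k) (by omega)).exists_link hp hb
      have : (heard G t p k).ncard < (heard G t p (k + 1)).ncard :=
        Set.ncard_lt_ncard ⟨hsub, fun h => hy (h (Or.inr ⟨x, hx, hxy⟩))⟩ (Set.toFinite _)
      omega

lemma heard_eq_univ (hG : G.OneIntervalConnected) {t : ℕ} (p : Fin n) {k : ℕ} (hk : k ≤ t)
    (hn : n ≤ k + 1) : heard G t p k = Set.univ := by
  have h := le_ncard_heard hG t p k hk
  rw [min_eq_left hn] at h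
  refine Set.eq_of_subset_of_ncard_le (Set.subset_univ _) ?_ (Set.toFinite _)
  rwa [Set.ncard_univ, Nat.card_fin]

/-- Processes with the same view after round `t` have heard of the same views of the previous
rounds. -/
lemma exists_heard_view_eq {lam : Fin n → J} {n' : ℕ} {G' : DynamicNetwork n'} {lam' : Fin n' → J} {t : ℕ}
    {p : Fin n} {p' : Fin n'} (h : view G lam t p = view G' lam' t p') (k s : ℕ) (hs : s + k = t) :
    ∀ q ∈ heard G t p k, ∃ q' ∈ heard G' t p' k, view G lam s q = view G' lam' s q' := by
  induction k generalizing s with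
  | zero =>
    rintro q rfl
    obtain rfl : s = t := hs
    exact ⟨p', rfl, h⟩
  | succ k ih =>
    have ih := ih (s + 1) (by omega)
    have hts : t - k = s + 1 := by omega
    rintro q (hq | ⟨r, hr, hrq⟩)
    · obtain ⟨q', hq', he⟩ := ih q hq
      exact ⟨q', Or.inl hq', view_eq_of_succ he⟩
    · obtain ⟨r', hr', he⟩ := ih r hr
      rw [hts] at hrq
      have hm : view G lam s q ∈ (view G lam (s + 1) r).2 :=
        (mem_view_succ_snd G lam s r _).2 ⟨q, hrq, rfl⟩
      rw [he, mem_view_succ_snd] at hm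
      obtain ⟨q', h1, h2⟩ := hm
      exact ⟨q', Or.inr ⟨r', hr', by rwa [hts]⟩, h2.symm⟩

end Views

/-! ### Classes of processes with equal views -/

section Classes

open scoped Classical in
/-- The processes that have view `w` after round `t`. -/
noncomputable def viewClass {n : ℕ} (G : DynamicNetwork n) (lam : Fin n → J) (t : ℕ)
    (w : View J t) : Finset (Fin n) :=
  Finset.univ.filter fun p => view G lam t p = w

variable {n : ℕ} {G : DynamicNetwork n} {lam : Fin n → J} {t : ℕ}

@[simp] lemma mem_viewClass {w : View J t} {p : Fin n} :
    p ∈ viewClass G lam t w ↔ view G lam t p = w := by simp [viewClass]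

lemma viewClass_succ_subset (w : View J (t + 1)) :
    viewClass G lam (t + 1) w ⊆ viewClass G lam t w.prev := by
  intro p hp
  rw [mem_viewClass] at hp ⊢
  rw [← hp, prev_view_succ]

open scoped Classical in
lemma count_view_succ_snd (p : Fin n) (v : View J t) :
    (view G lam (t + 1) p).2.count v = ∑ q ∈ viewClass G lam t v, G (t + 1) s(p, q) := by
  change (∑ q : Fin n, G (t + 1) s(p, q) • ({view G lam t q} : Multiset (View J t))).count v = _
  rw [Multiset.count_sum', viewClass, Finset.sum_filter]
  refine Finset.sum_congr rfl fun q _ => ?_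
  rw [Multiset.count_nsmul, Multiset.count_singleton]
  by_cases h : view G lam t q = v
  · simp [h]
  · simp [h, Ne.symm h]

open scoped Classical in
/-- The links between two classes can be counted from either side. -/
lemma sum_count_comm (G : DynamicNetwork n) (lam : Fin n → J) (u v : View J t) :
    ∑ p ∈ viewClass G lam t u, (view G lam (t + 1) p).2.count v =
      ∑ p ∈ viewClass G lam t v, (view G lam (t + 1) p).2.count u := by
  simp_rw [count_view_succ_snd]
  rw [Finset.sum_comm]
  simp_rw [Sym2.eq_swap]

open scoped Classical in
/-- The views that occur after round `t`. -/
noncomputable def views (G : DynamicNetwork n) (lam : Fin n → J) (t : ℕ) : Finset (View J t) :=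
  Finset.univ.image (view G lam t)

open scoped Classical in
lemma image_prev_view_succ (F : Finset (Fin n)) :
    (F.image (view G lam (t + 1))).image View.prev = F.image (view G lam t) := by
  rw [Finset.image_image]; rfl

open scoped Classical in
lemma card_image_view_le_succ (F : Finset (Fin n)) :
    (F.image (view G lam t)).card ≤ (F.image (view G lam (t + 1))).card := by
  rw [← image_prev_view_succ]
  exact Finset.card_image_le

/-- If the number of views does not increase, then the classes remain the same. -/
lemma view_succ_eq_of_card (h : (views G lam (t + 1)).card = (views G lam t).card) {p q : Fin n}
    (hpq : view G lam t p = view G lam t q) : view G lam (t + 1) p = view G lam (t + 1) q := by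
  classical
  have hinj : Set.InjOn View.prev (views G lam (t + 1) : Set (View J (t + 1))) := by
    refine Finset.injOn_of_card_image_eq ?_
    rw [h, views, image_prev_view_succ, views]
  have hmem : ∀ r, view G lam (t + 1) r ∈ (views G lam (t + 1) : Set (View J (t + 1))) :=
    fun r => Finset.mem_coe.2 (Finset.mem_image_of_mem _ (Finset.mem_univ r))
  exact hinj (hmem p) (hmem q) hpq

lemma viewClass_succ_eq_of_card (h : (views G lam (t + 1)).card = (views G lam t).card)
    (p : Fin n) :
    viewClass G lam (t + 1) (view G lam (t + 1) p) = viewClass G lam t (view G lam t p) := by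
  ext q
  simp only [mem_viewClass]
  exact ⟨view_eq_of_succ, view_succ_eq_of_card h⟩

lemma card_views_le : (views G lam t).card ≤ n := by
  classical
  exact Finset.card_image_le.trans_eq (by simp)

end Classes

/-! ### Comparing two networks that share views -/

section Compare

variable {I : Type u} {n n' : ℕ} {G : DynamicNetwork n} {G' : DynamicNetwork n'}

/-- A view records the input at its root, so only the unique leader can hold a view with the leader
flag. -/
lemma viewClass_leader {lam : Fin n → LeaderFlag × I} {l : Fin n}
    (hl : ∀ p, (lam p).1 = LeaderFlag.leader → p = l)
    (t : ℕ) {w : View (LeaderFlag × I) t} (hw : (w.root t).1 = LeaderFlag.leader) :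
    (viewClass G lam t w).card ≤ 1 := by
  rw [Finset.card_le_one]
  have : ∀ p ∈ viewClass G lam t w, p = l := by
    intro p hp
    rw [mem_viewClass] at hp
    apply hl
    rw [← root_view G lam t p, hp, hw]
  intro a ha b hb
  rw [this a ha, this b hb]

variable {lam : Fin n → LeaderFlag × I} {lam' : Fin n' → LeaderFlag × I}

/-- If no class of the first network splits in a round, but the sizes of some classes differ in the
two networks, then some class loses processes in the second network, and its size becomes at most
the size of the corresponding class of the first network. -/
lemma exists_card_viewClass_lt {t : ℕ} (hG : G.OneIntervalConnected) (hu : HasUniqueLeader lam)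
    (hu' : HasUniqueLeader lam')
    (hvis : ∀ p, ∃ p', view G lam (t + 1) p = view G' lam' (t + 1) p')
    (hcard : (views G lam (t + 1)).card = (views G lam t).card)
    (hne : ∃ p, (viewClass G' lam' t (view G lam t p)).card ≠
      (viewClass G lam t (view G lam t p)).card) :
    ∃ p, (viewClass G' lam' (t + 1) (view G lam (t + 1) p)).card <
        (viewClass G' lam' t (view G lam t p)).card ∧
      (viewClass G' lam' (t + 1) (view G lam (t + 1) p)).card ≤
        (viewClass G lam (t + 1) (view G lam (t + 1) p)).card := by
  classical
  obtain ⟨l, hl, hl1⟩ := hu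
  obtain ⟨l', hl', hl1'⟩ := hu'
  obtain ⟨b, hb⟩ := hne
  -- Classes with equal sizes in both networks that lose nobody in `G'` this round. The leader is in
  -- `K` and `b` is not, so some link leaves `K`.
  let K : Set (Fin n) := {q | (viewClass G' lam' t (view G lam t q)).card =
      (viewClass G lam t (view G lam t q)).card ∧
    (viewClass G' lam' (t + 1) (view G lam (t + 1) q)).card =
      (viewClass G' lam' t (view G lam t q)).card}
  have hsub : ∀ q, viewClass G' lam' (t + 1) (view G lam (t + 1) q) ⊆
      viewClass G' lam' t (view G lam t q) := fun q => viewClass_succ_subset _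
  have hlK : l ∈ K := by
    have hr : ((view G lam t l).root t).1 = LeaderFlag.leader := by rw [root_view]; exact hl
    have h1 := viewClass_leader (G := G) hl1 t hr
    have h2 := viewClass_leader (G := G') hl1' t hr
    have h3 := Finset.card_le_card (hsub l)
    have h4 : 0 < (viewClass G lam t (view G lam t l)).card :=
      Finset.card_pos.2 ⟨l, mem_viewClass.2 rfl⟩
    obtain ⟨x, hx⟩ := hvis l
    have h5 : 0 < (viewClass G' lam' (t + 1) (view G lam (t + 1) l)).card :=
      Finset.card_pos.2 ⟨x, mem_viewClass.2 hx.symm⟩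
    exact ⟨by omega, by omega⟩
  obtain ⟨q, hq, r, hr, hqr⟩ :=
    (hG (t + 1) (by omega)).exists_link hlK (b := b) (fun h => hb h.1)
  set u := view G lam t q
  set v := view G lam t r
  set m := (view G lam (t + 1) q).2.count v
  set m' := (view G lam (t + 1) r).2.count u with hm'
  have hm'pos : 0 < m' := by
    rw [hm', Multiset.count_pos, mem_view_succ_snd]
    exact ⟨q, by rwa [Sym2.eq_swap], rfl⟩
  have e1 : ∑ p ∈ viewClass G lam t u, (view G lam (t + 1) p).2.count v =
      (viewClass G lam t u).card * m := by
    refine Finset.sum_const_nat fun x hx => ?_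
    rw [view_succ_eq_of_card hcard (mem_viewClass.1 hx)]
  have e2 : ∑ p ∈ viewClass G lam t v, (view G lam (t + 1) p).2.count u =
      (viewClass G lam t v).card * m' := by
    refine Finset.sum_const_nat fun x hx => ?_
    rw [view_succ_eq_of_card hcard (mem_viewClass.1 hx)]
  -- Since `q ∈ K`, the whole class of `u` in `G'` still shares the new view of `q`, hence the same
  -- multiplicity `m`.
  have e3 : ∑ p ∈ viewClass G' lam' t u, (view G' lam' (t + 1) p).2.count v =
      (viewClass G' lam' t u).card * m := by
    rw [← Finset.eq_of_subset_of_card_le (hsub q) hq.2.ge]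
    refine Finset.sum_const_nat fun x hx => ?_
    rw [mem_viewClass.1 hx]
  have e4 : ∑ p ∈ viewClass G' lam' (t + 1) (view G lam (t + 1) r),
      (view G' lam' (t + 1) p).2.count u =
      (viewClass G' lam' (t + 1) (view G lam (t + 1) r)).card * m' := by
    refine Finset.sum_const_nat fun x hx => ?_
    rw [mem_viewClass.1 hx]
  have e5 : (viewClass G' lam' t u).card * m = (viewClass G lam t v).card * m' := by
    rw [hq.1, ← e1, ← e2, sum_count_comm]
  rw [sum_count_comm] at e3
  -- If the class of `r` lost nobody, the two link counts would force equal sizes and put `r` in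
  -- `K`. In any case, the holders of the new view of `r` account for only part of the links.
  refine ⟨r, (Finset.card_le_card (hsub r)).lt_of_ne fun h => hr ⟨?_, h⟩, ?_⟩
  · rw [Finset.eq_of_subset_of_card_le (hsub r) h.ge, e3, e5] at e4
    exact (Nat.eq_of_mul_eq_mul_right hm'pos e4).symm
  · rw [viewClass_succ_eq_of_card hcard]
    refine Nat.le_of_mul_le_mul_right ?_ hm'pos
    rw [← e4, ← e5, ← e3]
    exact Finset.sum_le_sum_of_subset (hsub r)

open scoped Classical in
/-- The processes of the second network whose view after round `t` is the view of a process of the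
first network in `F`. -/
noncomputable def sameView (G : DynamicNetwork n) (G' : DynamicNetwork n')
    (lam : Fin n → LeaderFlag × I) (lam' : Fin n' → LeaderFlag × I) (t : ℕ)
    (F : Finset (Fin n)) : Finset (Fin n') :=
  Finset.univ.filter fun p' => ∃ q ∈ F, view G lam t q = view G' lam' t p'

lemma mem_sameView {t : ℕ} {F : Finset (Fin n)} {p' : Fin n'} :
    p' ∈ sameView G G' lam lam' t F ↔ ∃ q ∈ F, view G lam t q = view G' lam' t p' := by
  simp [sameView]

lemma sameView_succ_subset (t : ℕ) (F : Finset (Fin n)) :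
    sameView G G' lam lam' (t + 1) F ⊆ sameView G G' lam lam' t F := by
  intro p' hp'
  obtain ⟨q, hq, h⟩ := mem_sameView.1 hp'
  exact mem_sameView.2 ⟨q, hq, view_eq_of_succ h⟩

open scoped Classical in
lemma card_image_le_card_sameView {t : ℕ}
    (hvis : ∀ p, ∃ p', view G lam t p = view G' lam' t p') (F : Finset (Fin n)) :
    (F.image (view G lam t)).card ≤ (sameView G G' lam lam' t F).card := by
  refine (Finset.card_le_card ?_).trans (Finset.card_image_le (f := view G' lam' t))
  intro w hw
  obtain ⟨q, hq, rfl⟩ := Finset.mem_image.1 hw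
  obtain ⟨p', hp'⟩ := hvis q
  exact Finset.mem_image.2 ⟨p', mem_sameView.2 ⟨q, hq, hp'⟩, hp'.symm⟩

open scoped Classical in
/-- As long as no round without splits has equal class sizes in the two networks, the set `F` of
the processes whose class has lost processes in the second network grows. -/
lemma exists_lossy_set (hG : G.OneIntervalConnected) (hu : HasUniqueLeader lam)
    (hu' : HasUniqueLeader lam') {T : ℕ}
    (hvis : ∀ s ≤ T, ∀ p, ∃ p', view G lam s p = view G' lam' s p')
    (hne : ∀ s < T, ∃ p, (viewClass G' lam' s (view G lam s p)).card ≠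
      (viewClass G lam s (view G lam s p)).card) (s : ℕ) (hs : s ≤ T) :
    ∃ F : Finset (Fin n), (∀ q ∈ F, (lam q).1 ≠ LeaderFlag.leader) ∧
      (∀ q ∈ F, ∀ r, view G lam s q = view G lam s r → r ∈ F) ∧
      s + 1 + (sameView G G' lam lam' s F).card ≤
        F.card + (views G lam s).card + (F.image (view G lam s)).card := by
  induction s with
  | zero =>
    refine ⟨∅, by simp, by simp, ?_⟩
    obtain ⟨l, -, -⟩ := hu
    have : 0 < (views G lam 0).card :=
      Finset.card_pos.2 ⟨_, Finset.mem_image_of_mem _ (Finset.mem_univ l)⟩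
    simp only [sameView, Finset.notMem_empty, false_and, exists_false, Finset.filter_false,
      Finset.card_empty, Finset.image_empty]
    omega
  | succ s ih =>
    obtain ⟨F, hF1, hF2, hF3⟩ := ih (by omega)
    have hF2' : ∀ q ∈ F, ∀ r, view G lam (s + 1) q = view G lam (s + 1) r → r ∈ F :=
      fun q hq r h => hF2 q hq r (view_eq_of_succ h)
    have hP := Finset.card_le_card (sameView_succ_subset (G := G) (G' := G') (lam := lam)
      (lam' := lam') s F)
    have hi := card_image_view_le_succ (G := G) (lam := lam) (t := s) F
    rcases (card_image_view_le_succ (G := G) (lam := lam) (t := s) Finset.univ).lt_or_eq with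
      hlt | heq
    · refine ⟨F, hF1, hF2', ?_⟩
      change (views G lam s).card < (views G lam (s + 1)).card at hlt
      omega
    · replace heq : (views G lam (s + 1)).card = (views G lam s).card := heq.symm
      obtain ⟨q, hq1, hq2⟩ :=
        exists_card_viewClass_lt hG hu hu' (hvis (s + 1) hs) heq (hne s (by omega))
      -- For `q ∈ F`, whoever leaves the class of `q` leaves `sameView`: without splits in `G`, the
      -- old view has a single continuation there.
      by_cases hqF : q ∈ F
      · refine ⟨F, hF1, hF2', ?_⟩
        obtain ⟨x, hx1, hx2⟩ := Finset.exists_mem_notMem_of_card_lt_card hq1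
        rw [mem_viewClass] at hx1 hx2
        have : (sameView G G' lam lam' (s + 1) F).card < (sameView G G' lam lam' s F).card := by
          refine Finset.card_lt_card
            ⟨sameView_succ_subset s F, fun h => ?_⟩
          obtain ⟨r, hr, hrx⟩ := mem_sameView.1 (h (mem_sameView.2 ⟨q, hqF, hx1.symm⟩))
          have hrq : view G lam s r = view G lam s q := (view_eq_of_succ hrx).trans hx1
          exact hx2 (hrx.symm.trans (view_succ_eq_of_card heq hrq))
        omega
      -- For `q ∉ F`, its class joins `F`: `F.card` grows at least as much as `sameView`, by the
      -- size bound `hq2`, and one new view is gained.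
      · have hdisj : Disjoint F (viewClass G lam (s + 1) (view G lam (s + 1) q)) := by
          rw [Finset.disjoint_left]
          intro r hr hrq
          exact hqF (hF2' r hr q (mem_viewClass.1 hrq))
        refine ⟨F ∪ viewClass G lam (s + 1) (view G lam (s + 1) q), ?_, ?_, ?_⟩
        · intro r hr
          rcases Finset.mem_union.1 hr with hr | hr
          · exact hF1 r hr
          · intro hlead
            -- The leader's class has at most one process in `G'` and stays nonempty there, so it
            -- cannot lose any.
            rw [mem_viewClass] at hr
            obtain ⟨l', -, hl'⟩ := hu'
            have h1 : (viewClass G' lam' s (view G lam s q)).card ≤ 1 := by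
              refine viewClass_leader hl' s ?_
              rw [← view_eq_of_succ hr, root_view, hlead]
            obtain ⟨x, hx⟩ := hvis (s + 1) hs q
            have h2 : 0 < (viewClass G' lam' (s + 1) (view G lam (s + 1) q)).card :=
              Finset.card_pos.2 ⟨x, mem_viewClass.2 hx.symm⟩
            omega
        · intro r hr x hrx
          rcases Finset.mem_union.1 hr with hr | hr
          · exact Finset.mem_union_left _ (hF2' r hr x hrx)
          · exact Finset.mem_union_right _ (mem_viewClass.2 (hrx.symm.trans (mem_viewClass.1 hr)))
        · rw [Finset.card_union_of_disjoint hdisj]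
          have h1 : (sameView G G' lam lam' (s + 1)
              (F ∪ viewClass G lam (s + 1) (view G lam (s + 1) q))).card ≤
              (sameView G G' lam lam' s F).card +
                (viewClass G' lam' (s + 1) (view G lam (s + 1) q)).card := by
            refine (Finset.card_le_card ?_).trans (Finset.card_union_le _ _)
            intro x hx
            obtain ⟨r, hr, hrx⟩ := mem_sameView.1 hx
            rcases Finset.mem_union.1 hr with hr | hr
            · exact Finset.mem_union_left _ (mem_sameView.2 ⟨r, hr, view_eq_of_succ hrx⟩)
            · exact Finset.mem_union_right _
                (mem_viewClass.2 (hrx.symm.trans (mem_viewClass.1 hr)))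
          have h2 : (F.image (view G lam (s + 1))).card <
              ((F ∪ viewClass G lam (s + 1) (view G lam (s + 1) q)).image
                (view G lam (s + 1))).card := by
            refine Finset.card_lt_card ⟨Finset.image_subset_image Finset.subset_union_left,
              fun h => ?_⟩
            obtain ⟨r, hr, hrq⟩ := Finset.mem_image.1 (h (Finset.mem_image_of_mem _
              (Finset.mem_union_right _ (mem_viewClass.2 (rfl : view G lam (s + 1) q = _)))))
            exact hqF (hF2' r hr q hrq)
          omega

/-- If the second network exhibits all the views of the first one up to round `2 * n - 1`, then the
class sizes agree after some earlier round. -/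
lemma exists_card_viewClass_eq (hG : G.OneIntervalConnected) (hu : HasUniqueLeader lam)
    (hu' : HasUniqueLeader lam')
    (hvis : ∀ s ≤ 2 * n - 1, ∀ p, ∃ p', view G lam s p = view G' lam' s p') :
    ∃ s < 2 * n - 1, ∀ p, (viewClass G' lam' s (view G lam s p)).card =
      (viewClass G lam s (view G lam s p)).card := by
  classical
  by_contra! hne
  obtain ⟨F, hF1, -, hF3⟩ := exists_lossy_set hG hu hu' hvis hne _ le_rfl
  have h1 := card_image_le_card_sameView (hvis _ le_rfl) F
  have h2 := card_views_le (G := G) (lam := lam) (t := 2 * n - 1)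
  obtain ⟨l, hl, -⟩ := hu
  have h3 : F.card < n := by
    have : F.card < (Finset.univ : Finset (Fin n)).card :=
      Finset.card_lt_card (Finset.ssubset_univ_iff.2 fun h => hF1 l (h ▸ Finset.mem_univ l) hl)
    simpa using this
  omega

/-- The view of a process after round `3 * n - 2` determines the inventory. -/
theorem inventory_eq_of_view_eq (hn : 1 ≤ n) (hG : G.OneIntervalConnected)
    (hG' : G'.OneIntervalConnected) (hu : HasUniqueLeader lam) (hu' : HasUniqueLeader lam')
    {p : Fin n} {p' : Fin n'}
    (h : view G lam (3 * n - 2) p = view G' lam' (3 * n - 2) p') :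
    inventory lam' = inventory lam := by
  classical
  obtain ⟨s, hs, hcard⟩ := exists_card_viewClass_eq hG hu hu' (G' := G') (lam' := lam') (by
    intro s hs q
    -- As `s ≤ 2 * n - 1`, at least `n - 1` rounds remain, enough to hear of all of `G`.
    have hq : q ∈ heard G (3 * n - 2) p (3 * n - 2 - s) := by
      rw [heard_eq_univ hG p (by omega) (by omega)]
      exact Set.mem_univ q
    obtain ⟨q', -, hq'⟩ := exists_heard_view_eq h (3 * n - 2 - s) s (by omega) q hq
    exact ⟨q', hq'⟩)
  have hP : (sameView G G' lam lam' s Finset.univ).card = n := by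
    have h1 : (sameView G G' lam lam' s Finset.univ).card =
        ∑ w ∈ views G lam s, (viewClass G' lam' s w).card := by
      rw [Finset.card_eq_sum_card_fiberwise (f := view G' lam' s) (t := views G lam s)]
      · refine Finset.sum_congr rfl fun w hw => ?_
        congr 1
        ext x
        obtain ⟨q, -, rfl⟩ := Finset.mem_image.1 hw
        simp only [Finset.mem_filter, mem_sameView, mem_viewClass, and_iff_right_iff_imp]
        exact fun hx => ⟨q, Finset.mem_univ q, hx.symm⟩
      · intro x hx
        obtain ⟨q, -, hq⟩ := mem_sameView.1 hx
        exact Finset.mem_coe.2 (Finset.mem_image.2 ⟨q, Finset.mem_univ q, hq⟩)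
    have h2 : ∑ w ∈ views G lam s, (viewClass G lam s w).card = n := by
      have := Finset.card_eq_sum_card_image (view G lam s) Finset.univ
      rw [Finset.card_fin] at this
      exact this.symm
    refine h1.trans (Eq.trans ?_ h2)
    refine Finset.sum_congr rfl fun w hw => ?_
    obtain ⟨q, -, rfl⟩ := Finset.mem_image.1 hw
    exact hcard q
  have hX : heard G' (3 * n - 2) p' (3 * n - 2 - s) ⊆
      (sameView G G' lam lam' s Finset.univ : Set (Fin n')) := by
    intro x hx
    obtain ⟨q, -, hq⟩ := exists_heard_view_eq h.symm (3 * n - 2 - s) s (by omega) x hx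
    exact mem_sameView.2 ⟨q, Finset.mem_univ q, hq.symm⟩
  have hle := Set.ncard_le_ncard hX (Set.toFinite _)
  rw [Set.ncard_coe_finset, hP] at hle
  -- Now `s ≤ 2 * n - 2`, so at least `n` rounds remain: `p'` hears of at least `min n' (n + 1)`
  -- processes, but of at most `n`. Hence `n' ≤ n` and `p'` hears of everyone.
  have hmin := le_ncard_heard hG' (3 * n - 2) p' (3 * n - 2 - s) (by omega)
  have hX2 := heard_eq_univ hG' (t := 3 * n - 2) p' (k := 3 * n - 2 - s) (by omega) (by omega)
  have hall : ∀ x, ∃ q, view G lam s q = view G' lam' s x := by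
    intro x
    obtain ⟨q, -, hq⟩ := mem_sameView.1 (Finset.mem_coe.1 (hX (hX2 ▸ Set.mem_univ x)))
    exact ⟨q, hq⟩
  have key : (Finset.univ : Finset (Fin n')).val.map (view G' lam' s) =
      (Finset.univ : Finset (Fin n)).val.map (view G lam s) := by
    ext w
    rw [Multiset.count_map, Multiset.count_map]
    simp only [eq_comm (a := w)]
    change (viewClass G' lam' s w).card = (viewClass G lam s w).card
    by_cases hw : ∃ q, view G lam s q = w
    · obtain ⟨q, rfl⟩ := hw
      exact hcard q
    · have e1 : viewClass G lam s w = ∅ :=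
        Finset.eq_empty_of_forall_notMem fun q hq => hw ⟨q, mem_viewClass.1 hq⟩
      have e2 : viewClass G' lam' s w = ∅ :=
        Finset.eq_empty_of_forall_notMem fun x hx =>
          hw ((hall x).imp fun q hq => hq.trans (mem_viewClass.1 hx))
      rw [e1, e2, Finset.card_empty]
      rfl
  have := congrArg (Multiset.map (View.root s)) key
  rw [Multiset.map_map, Multiset.map_map] at this
  simpa only [inventory, Function.comp_def, root_view] using this

end Compare

/-! ### The algorithm and its correctness -/

section Protocol

variable {I : Type u}

/-- In every `1`-interval-connected network with a unique leader where some process has view `w`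
after round `t`, the inventory is `M`. -/
def Certifies {t : ℕ} (w : View (LeaderFlag × I) t) (M : Multiset (LeaderFlag × I)) : Prop :=
  ∀ (n : ℕ) (G : DynamicNetwork n) (lam : Fin n → LeaderFlag × I) (p : Fin n),
    G.OneIntervalConnected → HasUniqueLeader lam → view G lam t p = w → inventory lam = M

/-- The views after round `t` among the received states. -/
noncomputable def viewsAt {T : Type u} (t : ℕ) (M : Multiset ((Σ s, View (LeaderFlag × I) s) ⊕ T)) :
    Multiset (View (LeaderFlag × I) t) :=
  M.filterMap fun x => match x with
    | Sum.inl y => if h : y.1 = t then some (h ▸ y.2) else none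
    | Sum.inr _ => none

open scoped Classical in
/-- Processes collect views until they receive a final result or their view certifies one. -/
noncomputable def viewAlgorithm (I : Type u) :
    Algorithm (LeaderFlag × I) (Multiset (LeaderFlag × I)) where
  NonTerminal := Σ t, View (LeaderFlag × I) t
  Terminal := Multiset (LeaderFlag × I)
  init x := Sum.inl ⟨0, x⟩
  output := id
  step s M :=
    if h : ∃ R, Sum.inr R ∈ M then Sum.inr h.choose
    else
      let w : View (LeaderFlag × I) (s.1 + 1) := (s.2, viewsAt s.1 M)
      if h : ∃ R, Certifies w R then Sum.inr h.choose else Sum.inl ⟨s.1 + 1, w⟩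

variable {n : ℕ} {G : DynamicNetwork n} {lam : Fin n → LeaderFlag × I}

lemma Certifies.eq_inventory {t : ℕ} {p : Fin n} {M : Multiset (LeaderFlag × I)}
    (hG : G.OneIntervalConnected) (hu : HasUniqueLeader lam)
    (h : Certifies (view G lam t p) M) : M = inventory lam :=
  (h n G lam p hG hu rfl).symm

lemma mem_received {A : Algorithm (LeaderFlag × I) (Multiset (LeaderFlag × I))}
    {E : Multigraph (Fin n)} {σ : Fin n → A.State} {p : Fin n} {x : A.State} :
    x ∈ A.received E σ p ↔ ∃ q, 0 < E s(p, q) ∧ σ q = x := by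
  simp [Algorithm.received, Multiset.mem_sum, Multiset.mem_nsmul, Nat.pos_iff_ne_zero, eq_comm]

/-- Only neighbours matter: if none has terminated, the received states are exactly their views and
the filter discards nothing. -/
lemma viewsAt_received {t : ℕ} {E : Multigraph (Fin n)} {σ : Fin n → (viewAlgorithm I).State}
    {f : Fin n → View (LeaderFlag × I) t} {p : Fin n}
    (h : ∀ q, 0 < E s(p, q) → σ q = Sum.inl ⟨t, f q⟩) :
    viewsAt t ((viewAlgorithm I).received E σ p) = ∑ q, E s(p, q) • {f q} := by
  have hr : (viewAlgorithm I).received E σ p =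
      (∑ q, E s(p, q) • ({f q} : Multiset (View (LeaderFlag × I) t))).map
        (fun w => (Sum.inl ⟨t, w⟩ : (viewAlgorithm I).State)) := by
    rw [← Multiset.coe_mapAddMonoidHom, map_sum, Algorithm.received]
    refine Finset.sum_congr rfl fun q _ => ?_
    rw [map_nsmul]
    rcases Nat.eq_zero_or_pos (E s(p, q)) with h0 | h0
    · rw [h0, zero_nsmul, zero_nsmul]
    · rw [h q h0]; rfl
  rw [hr]
  refine (Multiset.filterMap_map _ _ _).trans
    (Eq.trans (congrArg (fun g => Multiset.filterMap g _) ?_) (Multiset.filterMap_some _))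
  funext w
  exact dif_pos rfl

/-- After every round, a process either has its view as a state, which does not certify any result,
or has terminated with the correct output. -/
lemma state_viewAlgorithm (hG : G.OneIntervalConnected) (hu : HasUniqueLeader lam) (t : ℕ) :
    ∀ p, ((viewAlgorithm I).state G lam t p = Sum.inl ⟨t, view G lam t p⟩ ∧
        (1 ≤ t → ¬ ∃ R, Certifies (view G lam t p) R)) ∨
      (viewAlgorithm I).state G lam t p = Sum.inr (inventory lam) := by
  classical
  induction t with
  | zero => exact fun p => Or.inl ⟨rfl, by simp⟩
  | succ t ih =>
    intro p
    set σ := (viewAlgorithm I).state G lam t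
    change ((viewAlgorithm I).next (G (t + 1)) σ p = _ ∧ _) ∨
      (viewAlgorithm I).next (G (t + 1)) σ p = _
    rcases ih p with ⟨hp, -⟩ | hp
    · have hnext : (viewAlgorithm I).next (G (t + 1)) σ p =
          (viewAlgorithm I).step ⟨t, view G lam t p⟩
            ((viewAlgorithm I).received (G (t + 1)) σ p) := by
        rw [Algorithm.next, hp]
      rw [hnext]
      -- A terminated neighbour no longer sends its view, so the next view may be unavailable; its
      -- result, correct by induction, is copied instead.
      by_cases hR : ∃ R, Sum.inr R ∈ (viewAlgorithm I).received (G (t + 1)) σ p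
      · right
        have : (viewAlgorithm I).step ⟨t, view G lam t p⟩
            ((viewAlgorithm I).received (G (t + 1)) σ p) = Sum.inr hR.choose := dif_pos hR
        rw [this]
        obtain ⟨q, -, hq⟩ := mem_received.1 hR.choose_spec
        rcases ih q with ⟨hq', -⟩ | hq'
        · rw [hq'] at hq; cases hq
        · rw [← hq, hq']
      · have hw : ((view G lam t p, viewsAt t ((viewAlgorithm I).received (G (t + 1)) σ p)) :
            View (LeaderFlag × I) (t + 1)) = view G lam (t + 1) p := by
          refine congrArg (Prod.mk _) (viewsAt_received fun q hq => ?_)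
          rcases ih q with ⟨hq', -⟩ | hq'
          · exact hq'
          · exact absurd ⟨_, mem_received.2 ⟨q, hq, hq'⟩⟩ hR
        by_cases hC : ∃ R, Certifies (view G lam (t + 1) p) R
        · right
          rw [← hw] at hC
          have : (viewAlgorithm I).step ⟨t, view G lam t p⟩
              ((viewAlgorithm I).received (G (t + 1)) σ p) = Sum.inr hC.choose :=
            (dif_neg hR).trans (dif_pos hC)
          rw [this]
          have hspec := hC.choose_spec
          generalize hC.choose = R at hspec
          rw [hw] at hspec
          rw [hspec.eq_inventory hG hu]
        · left
          refine ⟨?_, fun _ => hC⟩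
          rw [← hw] at hC
          exact ((dif_neg hR).trans (dif_neg hC)).trans
            (congrArg (fun w => (Sum.inl ⟨t + 1, w⟩ : (viewAlgorithm I).State)) hw)
    · right
      rw [Algorithm.next, hp]
      rfl

end Protocol

end AnonNet

theorem mainTheorem1 (I : Type u) :
    ∃ A : AnonNet.Algorithm (AnonNet.LeaderFlag × I) (Multiset (AnonNet.LeaderFlag × I)),
      AnonNet.SolvesWithLeaderIn A (AnonNet.generalizedCounting (AnonNet.LeaderFlag × I))
        (fun n => 3 * n - 2) := by
  classical
  refine ⟨AnonNet.viewAlgorithm I, fun n G lam hn hG hu => ?_⟩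
  have hstate := AnonNet.state_viewAlgorithm hG hu
  have hall : (AnonNet.viewAlgorithm I).AllTerminal G lam (3 * n - 2) := by
    intro p
    rcases hstate (3 * n - 2) p with ⟨-, h⟩ | h
    · refine absurd ⟨AnonNet.inventory lam, ?_⟩ (h (by omega))
      intro n' G' lam' p' hG' hu' hv
      exact AnonNet.inventory_eq_of_view_eq hn hG hG' hu hu' hv.symm
    · exact ⟨_, h⟩
  have hex : ∃ t, (AnonNet.viewAlgorithm I).AllTerminal G lam t := ⟨_, hall⟩
  refine ⟨Nat.find hex, Nat.find_min' hex hall,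
    ⟨Nat.find_spec hex, fun t' ht' => Nat.find_min hex ht'⟩, fun p => ?_⟩
  obtain ⟨s, hs⟩ := Nat.find_spec hex p
  refine ⟨s, hs, ?_⟩
  rcases hstate (Nat.find hex) p with ⟨h, -⟩ | h
  · rw [h] at hs; cases hs
  · rw [h] at hs
    exact (Sum.inr.inj hs).symm
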